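/- A modal algebra is a Boolean algebra with a unary operation $\Diamond$ satisfying $\Diamond 0=0$ and $\Diamond(a\vee b)=\Diamond a\vee\Diamond b$; put $\Box a=\neg\Diamond\neg a$. A McKinsey algebra is a modal algebra satisfying the identity $(\Box\Diamond x\Rightarrow\Diamond\Box x)=1$. A closure algebra is a modal algebra with $a\le\Diamond a=\Diamond\Diamond a$ for all $a$, and a monadic algebra is a closure algebra with $\Diamond\Box a=\Box a$ for all $a$. Let $\mathbf 2$ be the two-element closure algebra, in which $\Diamond$ is the identity map. A variety is a class of modal algebras defined by identities; it is nontrivial if it contains an algebra with more than one element. For a variety $\mathcal K$ and a natural number $k$, let $\mathbf F_{\mathcal K}(k)$ be the free algebra for $\mathcal K$ of rank $k$, that is, the algebra of terms in $k$ variables modulo the congruence identifying terms that determine the same term operation on every algebra of $\mathcal K$. Let $\mathcal U$ be a nontrivial variety of McKinsey algebras, let $\mathcal W$ be a variety of monadic algebras, let $\mathcal V=\mathcal U\vee\mathcal W$ be their varietal join, i.e. the class defined by all identities that hold in every algebra of $\mathcal U\cup\mathcal W$, and let $k$ be a natural number. Then there are natural numbers $d,m$ and finite simple monadic algebras $\mathbf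 R_1,\dots,\mathbf R_m$ (not necessarily distinct), each with more than two elements, such that $$\mathbf F_{\mathcal W}(k)\cong\mathbf 2^d\times\prod_{l=1}^m\mathbf R_l ,$$ and for every such decomposition, with $\mathbf G_{\mathcal W}(k)=\prod_{l=1}^m\mathbf R_l$, $$\mathbf F_{\mathcal V}(k)\cong\mathbf F_{\mathcal U}(k)\times\mathbf G_{\mathcal W}(k).$$ -/

import Mathlib

universe u v w

/-- A (bundled) modal algebra: a Boolean algebra with a unary operation `◇` such that
`◇ 0 = 0` and `◇ (a ∨ b) = ◇ a ∨ ◇ b`. -/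
structure ModalAlg : Type (u + 1) where
  /-- the underlying set -/
  carrier : Type u
  /-- the Boolean algebra reduct -/
  [boolAlg : BooleanAlgebra carrier]
  /-- the operation `◇` -/
  dia : carrier → carrier
  dia_bot : dia ⊥ = ⊥
  dia_sup : ∀ a b : carrier, dia (a ⊔ b) = dia a ⊔ dia b

namespace ModalAlg

instance : CoeSort ModalAlg.{u} (Type u) := ⟨ModalAlg.carrier⟩

instance (A : ModalAlg.{u}) : BooleanAlgebra A := A.boolAlg

/-- `□ a = ¬ ◇ ¬ a`. -/
def box (A : ModalAlg.{u}) (a : A) : A := (A.dia aᶜ)ᶜ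

/-- The McKinsey term operation `μ(a) = (□◇a ⇒ ◇□a)`, where `a ⇒ b = ¬a ∨ b`. -/
def mckinsey (A : ModalAlg.{u}) (a : A) : A := (A.box (A.dia a))ᶜ ⊔ A.dia (A.box a)

/-- McKinsey algebras: modal algebras satisfying `μ(x) = 1`. -/
def IsMcKinsey (A : ModalAlg.{u}) : Prop := ∀ a : A, A.mckinsey a = ⊤

/-- Closure algebras: modal algebras satisfying `x ≤ ◇x = ◇◇x`. -/
def IsClosureAlg (A : ModalAlg.{u}) : Prop := ∀ a : A, a ≤ A.dia a ∧ A.dia (A.dia a) = A.dia a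

/-- Monadic algebras: closure algebras satisfying `◇□x = □x`. -/
def IsMonadic (A : ModalAlg.{u}) : Prop := A.IsClosureAlg ∧ ∀ a : A, A.dia (A.box a) = A.box a

/-- Homomorphisms of modal algebras. (Bounded lattice homomorphisms between Boolean algebras
preserve complements.) -/
structure Hom (A : ModalAlg.{u}) (B : ModalAlg.{v}) extends BoundedLatticeHom A B where
  map_dia' : ∀ a : A, toFun (A.dia a) = B.dia (toFun a)

/-- Isomorphisms of modal algebras: order isomorphisms (equivalently, isomorphisms of the
Boolean reducts) commuting with `◇`. -/
structure Iso (A : ModalAlg.{u}) (B : ModalAlg.{v}) extends A ≃o B where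
  map_dia' : ∀ a : A, toFun (A.dia a) = B.dia (toFun a)

/-- `A ≅ B`. -/
def Isomorphic (A : ModalAlg.{u}) (B : ModalAlg.{v}) : Prop := Nonempty (Iso A B)

/-- The two-element closure algebra `2`, on which `◇` is the identity. -/
def two : ModalAlg.{0} where
  carrier := Bool
  dia := id
  dia_bot := rfl
  dia_sup _ _ := rfl

/-- The direct product of two modal algebras. -/
def prod (A : ModalAlg.{u}) (B : ModalAlg.{v}) : ModalAlg.{max u v} where
  carrier := A × B
  dia p := (A.dia p.1, B.dia p.2)
  dia_bot := Prod.ext A.dia_bot B.dia_bot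
  dia_sup p q := Prod.ext (A.dia_sup p.1 q.1) (B.dia_sup p.2 q.2)

/-- The direct product of a family of modal algebras. -/
def pi {ι : Type v} (A : ι → ModalAlg.{u}) : ModalAlg.{max v u} where
  carrier := ∀ i, A i
  dia f := fun i => (A i).dia (f i)
  dia_bot := funext fun i => (A i).dia_bot
  dia_sup f g := funext fun i => (A i).dia_sup (f i) (g i)

/-- Congruences of a modal algebra: equivalence relations compatible with all operations. -/
structure Congruence (A : ModalAlg.{u}) extends Setoid A where
  sup : ∀ {a b c d : A}, r a b → r c d → r (a ⊔ c) (b ⊔ d)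
  inf : ∀ {a b c d : A}, r a b → r c d → r (a ⊓ c) (b ⊓ d)
  compl : ∀ {a b : A}, r a b → r aᶜ bᶜ
  dia : ∀ {a b : A}, r a b → r (A.dia a) (A.dia b)

/-- A nontrivial algebra is simple if the equality and the total relation are its only
congruences. -/
def IsSimple (A : ModalAlg.{u}) : Prop :=
  Nontrivial A ∧ ∀ θ : Congruence A, θ.toSetoid = ⊥ ∨ θ.toSetoid = ⊤

end ModalAlg

/-- Terms in the language of modal algebras with variables from `X`. -/
inductive ModalTerm (X : Type u) : Type u
  | var (x : X) : ModalTerm X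
  | bot : ModalTerm X
  | top : ModalTerm X
  | sup (s t : ModalTerm X) : ModalTerm X
  | inf (s t : ModalTerm X) : ModalTerm X
  | compl (s : ModalTerm X) : ModalTerm X
  | dia (s : ModalTerm X) : ModalTerm X

namespace ModalTerm

/-- The value of a term in a modal algebra under a valuation of the variables. -/
def eval {X : Type u} (A : ModalAlg.{v}) (f : X → A) : ModalTerm X → A
  | var x => f x
  | bot => ⊥
  | top => ⊤
  | sup s t => eval A f s ⊔ eval A f t
  | inf s t => eval A f s ⊓ eval A f t
  | compl s => (eval A f s)ᶜ
  | dia s => A.dia (eval A f s)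

/-- Simultaneous substitution. -/
def subst {X : Type u} {Y : Type v} (σ : X → ModalTerm Y) : ModalTerm X → ModalTerm Y
  | var x => σ x
  | bot => bot
  | top => top
  | sup s t => sup (subst σ s) (subst σ t)
  | inf s t => inf (subst σ s) (subst σ t)
  | compl s => compl (subst σ s)
  | dia s => dia (subst σ s)

theorem eval_subst {X : Type u} {Y : Type v} (A : ModalAlg.{w}) (f : Y → A)
    (σ : X → ModalTerm Y) (t : ModalTerm X) :
    eval A f (subst σ t) = eval A (fun x => eval A f (σ x)) t := by
  induction t <;> simp_all [eval, subst]

end ModalTerm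

namespace ModalAlg

/-- Identities `s = t`, in countably many variables. -/
abbrev Identity : Type := ModalTerm ℕ × ModalTerm ℕ

/-- `A` satisfies the identity `e`. -/
def Satisfies (A : ModalAlg.{u}) (e : Identity) : Prop :=
  ∀ f : ℕ → A, e.1.eval A f = e.2.eval A f

/-- The class of all modal algebras satisfying a set of identities. -/
def models (E : Set Identity) : Set ModalAlg.{u} := {A | ∀ e ∈ E, A.Satisfies e}

/-- The equational theory of a class of modal algebras. -/
def eqTheory (K : Set ModalAlg.{u}) : Set Identity := {e | ∀ A ∈ K, A.Satisfies e}

/-- A variety (of modal algebras) is a class defined by identities. -/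
def IsVariety (K : Set ModalAlg.{u}) : Prop := ∃ E : Set Identity, K = models E

/-- The variety generated by a class: the class defined by its equational theory. -/
def generated (K : Set ModalAlg.{u}) : Set ModalAlg.{u} := models (eqTheory K)

/-- The varietal join: the variety generated by the union. -/
def varJoin (U W : Set ModalAlg.{u}) : Set ModalAlg.{u} := generated (U ∪ W)

/-- Two terms are identified if they determine the same term operation on every algebra
from `K`. -/
def termSetoid (K : Set ModalAlg.{u}) (X : Type) : Setoid (ModalTerm X) where
  r s t := ∀ A ∈ K, ∀ f : X → A, s.eval A f = t.eval A f
  iseqv :=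
    ⟨fun _ _ _ _ => rfl, fun h A hA f => (h A hA f).symm,
      fun h h' A hA f => (h A hA f).trans (h' A hA f)⟩

/-- The carrier of the free algebra: terms over `X` modulo the identities valid in `K`. -/
def FreeCarrier (K : Set ModalAlg.{u}) (X : Type) : Type := Quotient (termSetoid K X)

namespace FreeCarrier

variable {K : Set ModalAlg.{u}} {X : Type}

/-- The term operations on algebras of `K` given by an element of the free algebra. -/
def toFun (a : FreeCarrier K X) (p : Σ A : K, X → A.1) : p.1.1 :=
  Quotient.lift (fun t : ModalTerm X => t.eval p.1.1 p.2)
    (fun s t (h : termSetoid K X s t) => h p.1.1 p.1.2 p.2) a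

theorem toFun_injective :
    Function.Injective (toFun : FreeCarrier K X → ∀ p : Σ A : K, X → A.1, p.1.1) := by
  intro a b
  refine Quotient.inductionOn₂ a b fun s t h => Quotient.sound fun A hA f => ?_
  exact congrFun h ⟨⟨A, hA⟩, f⟩

instance : Max (FreeCarrier K X) :=
  ⟨Quotient.map₂ ModalTerm.sup fun _ _ h _ _ h' A hA f =>
    congrArg₂ (· ⊔ ·) (h A hA f) (h' A hA f)⟩

instance : Min (FreeCarrier K X) :=
  ⟨Quotient.map₂ ModalTerm.inf fun _ _ h _ _ h' A hA f =>
    congrArg₂ (· ⊓ ·) (h A hA f) (h' A hA f)⟩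

instance : Compl (FreeCarrier K X) :=
  ⟨Quotient.map ModalTerm.compl fun _ _ h A hA f => congrArg (·ᶜ) (h A hA f)⟩

instance : Bot (FreeCarrier K X) := ⟨Quotient.mk _ ModalTerm.bot⟩
instance : Top (FreeCarrier K X) := ⟨Quotient.mk _ ModalTerm.top⟩
instance : LE (FreeCarrier K X) := ⟨fun a b => toFun a ≤ toFun b⟩
instance : LT (FreeCarrier K X) := ⟨fun a b => toFun a < toFun b⟩
instance : SDiff (FreeCarrier K X) := ⟨fun a b => a ⊓ bᶜ⟩
instance : HImp (FreeCarrier K X) := ⟨fun a b => b ⊔ aᶜ⟩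

theorem toFun_sup (a b : FreeCarrier K X) : toFun (a ⊔ b) = toFun a ⊔ toFun b :=
  Quotient.inductionOn₂ a b fun _ _ => rfl

theorem toFun_inf (a b : FreeCarrier K X) : toFun (a ⊓ b) = toFun a ⊓ toFun b :=
  Quotient.inductionOn₂ a b fun _ _ => rfl

theorem toFun_compl (a : FreeCarrier K X) : toFun aᶜ = (toFun a)ᶜ :=
  Quotient.inductionOn a fun _ => rfl

instance : BooleanAlgebra (FreeCarrier K X) :=
  toFun_injective.booleanAlgebra toFun Iff.rfl Iff.rfl toFun_sup toFun_inf rfl rfl toFun_compl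
    (fun a b => by
      rw [sdiff_eq, ← toFun_compl, ← toFun_inf]; rfl)
    (fun a b => by
      rw [himp_eq, ← toFun_compl, ← toFun_sup]; rfl)

end FreeCarrier

/-- The free algebra for the class `K` over the set `X` of variables: the algebra of terms
over `X` divided by the congruence identifying terms which determine the same term operation
on every algebra from `K`. -/
def free (K : Set ModalAlg.{u}) (X : Type) : ModalAlg.{0} where
  carrier := FreeCarrier K X
  dia := Quotient.map ModalTerm.dia fun _ _ h A hA f => congrArg A.dia (h A hA f)
  dia_bot := Quotient.sound fun A _ _ => A.dia_bot
  dia_sup a b := Quotient.inductionOn₂ a b fun _ _ => Quotient.sound fun A _ _ => A.dia_sup _ _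

/-- The element of the free algebra represented by a term. -/
def free.mk (K : Set ModalAlg.{u}) (X : Type) (t : ModalTerm X) : free K X :=
  Quotient.mk (termSetoid K X) t

/-- The free algebra `F_K(k)` of rank `k`, over `k` variables. -/
abbrev freeRank (K : Set ModalAlg.{u}) (k : ℕ) : ModalAlg.{0} := free K (Fin k)

theorem free.eval_mk (K : Set ModalAlg.{u}) (X : Type) {Y : Type v} (σ : Y → ModalTerm X)
    (t : ModalTerm Y) :
    t.eval (free K X) (fun y => free.mk K X (σ y)) = free.mk K X (t.subst σ) := by
  induction t with
  | var x => rfl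
  | bot => rfl
  | top => rfl
  | sup s t hs ht => exact congrArg₂ (· ⊔ ·) hs ht
  | inf s t hs ht => exact congrArg₂ (· ⊓ ·) hs ht
  | compl s hs => exact congrArg (·ᶜ) hs
  | dia s hs => exact congrArg (free K X).dia hs

/-- The free algebra belongs to the variety generated by `K`. -/
theorem free_mem (K : Set ModalAlg.{u}) (X : Type) : free K X ∈ models.{0} (eqTheory K) := by
  intro e he f
  have hf : ∃ σ : ℕ → ModalTerm X, f = fun y => free.mk K X (σ y) :=
    ⟨fun y => (f y).out, funext fun y => (Quotient.out_eq (f y)).symm⟩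
  obtain ⟨σ, rfl⟩ := hf
  rw [free.eval_mk, free.eval_mk]
  refine Quotient.sound fun A hA g => ?_
  rw [ModalTerm.eval_subst, ModalTerm.eval_subst]
  exact he A hA _

/-- The universal mapping property of the free algebra of rank `k`. -/
theorem freeRank_lift (K : Set ModalAlg.{u}) (k : ℕ) (A : ModalAlg.{v})
    (hA : A ∈ models.{v} (eqTheory K)) (f : Fin k → A) :
    ∃! h : Hom (freeRank K k) A, ∀ i, h.toFun (free.mk K (Fin k) (.var i)) = f i := by
  have key : ∀ s t : ModalTerm (Fin k), termSetoid K (Fin k) s t →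
      s.eval A f = t.eval A f := by
    intro s t hst
    have := hA (s.subst fun i => .var i.1, t.subst fun i => .var i.1) (by
        intro B hB g
        simp only [ModalTerm.eval_subst]
        exact hst B hB _)
      (fun n => if hn : n < k then f ⟨n, hn⟩ else ⊥)
    simpa [ModalTerm.eval_subst, ModalTerm.eval] using this
  let F : FreeCarrier K (Fin k) → A := Quotient.lift (fun t => t.eval A f) key
  refine ⟨⟨⟨⟨⟨F, ?_⟩, ?_⟩, ?_, ?_⟩, ?_⟩, ?_, ?_⟩
  · exact fun a b => Quotient.inductionOn₂ a b fun _ _ => rfl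
  · exact fun a b => Quotient.inductionOn₂ a b fun _ _ => rfl
  · rfl
  · rfl
  · exact fun a => Quotient.inductionOn a fun _ => rfl
  · exact fun _ => rfl
  · rintro h hh
    have hfun : ∀ t : ModalTerm (Fin k), h.toFun (free.mk K (Fin k) t) = t.eval A f := by
      intro t
      induction t with
      | var x => exact hh x
      | bot => exact h.map_bot'
      | top => exact h.map_top'
      | sup s t hs ht =>
        exact (h.map_sup' (free.mk K _ s) (free.mk K _ t)).trans (congrArg₂ (· ⊔ ·) hs ht)
      | inf s t hs ht =>
        exact (h.map_inf' (free.mk K _ s) (free.mk K _ t)).trans (congrArg₂ (· ⊓ ·) hs ht)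
      | compl s hs =>
        exact (map_compl' h.toBoundedLatticeHom (free.mk K _ s)).trans (congrArg (·ᶜ) hs)
      | dia s hs => exact (h.map_dia' (free.mk K _ s)).trans (congrArg A.dia hs)
    obtain ⟨h, hd⟩ := h
    congr 1
    exact BoundedLatticeHom.ext fun a => Quotient.inductionOn a hfun

/-- `F_W(k) ≅ 2^d × R_1 × ⋯ × R_m`, where all `R_l` are (not necessarily distinct) finite simple
monadic algebras with more than two elements. The product `R_1 × ⋯ × R_m` is then the algebra
`G_W(k)`. -/
def IsSimpleDecomposition (W : Set ModalAlg.{u}) (k d m : ℕ) (R : Fin m → ModalAlg.{0}) : Prop :=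
  (∀ l, (R l).IsMonadic ∧ (R l).IsSimple ∧ Finite (R l) ∧ 2 < Nat.card (R l)) ∧
    Isomorphic (freeRank W k) (prod (pi fun _ : Fin d => two) (pi R))

end ModalAlg

/-! Decomposition: finitely generated monadic algebras are finite
(`IsMonadic.exists_finite_closed`), so the free monadic algebra is finite. On the atoms of a finite
monadic algebra, `◇` acts through the equivalence `◇x = ◇y`; singleton classes give factors `2`,
larger ones simple powerset algebras.

Join: send a term `t` to its class in `F_U(k)` and its value in `G = ∏ R_l`. An identity of `V` is a
common identity of `U` and `W`, and an identity of `W` in `k` variables is one holding at the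
generators of `2^d × G`. The factor `2^d` imposes nothing new, since `2` embeds in every nontrivial
McKinsey algebra (`IsMcKinsey.eval_two_eq`); hence the map is injective. For surjectivity, some term
`r` takes a value other than `0`, `1` in every `R_l`. Then `μ(r)` is `1` throughout `U` but `0` in
`G` (`IsMonadic.mckinsey_eq_bot`), so it glues arbitrary terms for the two factors. -/

namespace ModalAlg

/-! ### Monadic algebras: closed elements, simplicity, local finiteness -/

section Monadic

variable {A : ModalAlg.{u}}

theorem dia_mono {a b : A} (h : a ≤ b) : A.dia a ≤ A.dia b := by
  rw [← sup_eq_right.2 h, A.dia_sup]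
  exact le_sup_left

theorem IsMonadic.dia_compl (hA : A.IsMonadic) {c : A} (hc : A.dia c = c) :
    A.dia cᶜ = cᶜ := by
  simpa [box, hc] using hA.2 cᶜ

/-- Split `b` along `c`: since `cᶜ` is closed too, the part of `b` outside `c` stays outside `c`
under `◇`. -/
theorem IsMonadic.dia_inf (hA : A.IsMonadic) (b : A) {c : A} (hc : A.dia c = c) :
    A.dia (b ⊓ c) = A.dia b ⊓ c := by
  apply le_antisymm
  · exact le_inf (dia_mono inf_le_left) ((dia_mono inf_le_right).trans hc.le)
  · have h : A.dia b ≤ A.dia (b ⊓ c) ⊔ cᶜ := by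
      calc A.dia b = A.dia (b ⊓ c) ⊔ A.dia (b ⊓ cᶜ) := by rw [← A.dia_sup, sup_inf_inf_compl]
        _ ≤ _ := sup_le_sup_left ((dia_mono inf_le_right).trans (hA.dia_compl hc).le) _
    calc A.dia b ⊓ c ≤ (A.dia (b ⊓ c) ⊔ cᶜ) ⊓ c := inf_le_inf_right _ h
      _ ≤ A.dia (b ⊓ c) := by simp [inf_sup_right]

/-- Because `◇a` is closed, equality modulo joining with `◇a` is a congruence. It collapses `◇a ≥ a
≠ ⊥` to `⊥`, so by simplicity it is total. -/
theorem IsMonadic.dia_eq_top (hA : A.IsMonadic) (hs : A.IsSimple) {a : A} (ha : a ≠ ⊥) :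
    A.dia a = ⊤ := by
  have hc : A.dia (A.dia a) = A.dia a := (hA.1 a).2
  let θ : Congruence A :=
    { r := fun x y => x ⊔ A.dia a = y ⊔ A.dia a
      iseqv := ⟨fun _ => rfl, fun h => h.symm, fun h h' => h.trans h'⟩
      sup := by
        intro p q r s h h'
        rw [sup_sup_distrib_right, h, h', ← sup_sup_distrib_right]
      inf := by
        intro p q r s h h'
        rw [sup_inf_right, h, h', ← sup_inf_right]
      compl := by
        intro p q h
        have key : ∀ x : A, xᶜ ⊔ A.dia a = (x ⊔ A.dia a)ᶜ ⊔ A.dia a := fun x => by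
          rw [compl_sup, sup_inf_right, compl_sup_eq_top, inf_top_eq]
        rw [key p, key q, h]
      dia := by
        intro p q h
        have := congrArg A.dia h
        rwa [A.dia_sup, A.dia_sup, hc] at this }
  rcases hs.2 θ with h | h
  · have : θ.r (A.dia a) ⊥ := by change A.dia a ⊔ A.dia a = ⊥ ⊔ A.dia a; simp
    have h0 : A.dia a = ⊥ := by
      have h1 : θ.toSetoid (A.dia a) ⊥ := this
      rw [h] at h1
      exact h1
    exact absurd (le_bot_iff.1 ((hA.1 a).1.trans h0.le)) ha
  · have : θ.toSetoid ⊤ ⊥ := by rw [h]; trivial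
    have h1 : ⊤ ⊔ A.dia a = ⊥ ⊔ A.dia a := this
    simpa using h1.symm

/-- In a simple monadic algebra, the McKinsey term vanishes outside `{⊥, ⊤}`. -/
theorem IsMonadic.mckinsey_eq_bot (hA : A.IsMonadic) (hs : A.IsSimple) {a : A}
    (h0 : a ≠ ⊥) (h1 : a ≠ ⊤) : A.mckinsey a = ⊥ := by
  have h2 : A.dia aᶜ = ⊤ := hA.dia_eq_top hs (by simpa using h1)
  -- `□◇a = □⊤ = ⊤`, while `□a = ⊥` gives `◇□a = ⊥`.
  simp [mckinsey, box, hA.dia_eq_top hs h0, h2, A.dia_bot]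

/-- A finite set of elements of a monadic algebra is contained in a finite subalgebra. -/
theorem IsMonadic.exists_finite_closed (hA : A.IsMonadic) {V : Set A} (hV : V.Finite) :
    ∃ D : Set A, D.Finite ∧ V ⊆ D ∧ IsSublattice D ∧ ⊥ ∈ D ∧ ⊤ ∈ D ∧
      (∀ a ∈ D, aᶜ ∈ D) ∧ ∀ a ∈ D, A.dia a ∈ D := by
  have hcompl : ∀ T : Set A, (∀ a ∈ T, aᶜ ∈ T) → ∀ a ∈ latticeClosure T, aᶜ ∈ latticeClosure T := by
    intro T hT a ha
    have himg : compl '' T = T := by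
      ext x
      exact ⟨by rintro ⟨y, hy, rfl⟩; exact hT y hy, fun hx => ⟨xᶜ, hT x hx, compl_compl x⟩⟩
    rw [← compl_image_latticeClosure_eq_of_compl_image_eq_self himg]
    exact ⟨a, ha, rfl⟩
  -- `S` is the Boolean subalgebra generated by `V`. Adjoining `◇b` and its complement for `b ∈ S`
  -- suffices: the new generators are closed, so `dia_inf` pulls them out of `◇`.
  set S : Set A := latticeClosure (V ∪ compl '' V ∪ {⊥, ⊤}) with hS
  have hSfin : S.Finite := ((hV.union (hV.image _)).union (by simp)).latticeClosure
  have hSc : ∀ a ∈ S, aᶜ ∈ S := by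
    apply hcompl
    rintro a ((ha | ⟨b, hb, rfl⟩) | rfl | rfl)
    · exact .inl (.inr ⟨a, ha, rfl⟩)
    · exact .inl (.inl (by simpa using hb))
    · simp
    · simp
  have hSsub : V ∪ compl '' V ∪ {⊥, ⊤} ⊆ S := subset_latticeClosure
  have hSbot : ⊥ ∈ S := hSsub (by simp)
  have hStop : ⊤ ∈ S := hSsub (by simp)
  have hSinf : InfClosed S := isSublattice_latticeClosure.infClosed
  set T : Set A := S ∪ (A.dia '' S ∪ compl '' (A.dia '' S)) with hT
  have hTfin : T.Finite := hSfin.union ((hSfin.image _).union ((hSfin.image _).image _))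
  have hTD : T ⊆ latticeClosure T := subset_latticeClosure
  have hD : IsSublattice (latticeClosure T) := isSublattice_latticeClosure
  refine ⟨latticeClosure T, hTfin.latticeClosure,
    fun a ha => hTD (.inl (hSsub (.inl (.inl ha)))), hD, hTD (.inl hSbot), hTD (.inl hStop), ?_, ?_⟩
  · apply hcompl
    rintro a (ha | ha | ⟨b, hb, rfl⟩)
    · exact .inl (hSc a ha)
    · exact .inr (.inr ⟨a, ha, rfl⟩)
    · exact .inr (.inl (by simpa using hb))
  -- Meets of elements of `T` have the form `b ⊓ c` with `b ∈ S` and `c` closed, and `◇(b ⊓ c) = ◇b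
  -- ⊓ c`. Every element of the lattice closure is a join of such meets, and `◇` preserves joins.
  · let N : Set A := {x | ∃ b ∈ S, ∃ c ∈ latticeClosure T, A.dia c = c ∧ x = b ⊓ c}
    have hN : infClosure T ⊆ N := by
      apply infClosure_min
      · have hclosed : ∀ x ∈ T, A.dia x = x → x ∈ N := fun x hx h =>
          ⟨⊤, hStop, x, hTD hx, h, by simp⟩
        rintro a (ha | ha | ha)
        · exact ⟨a, ha, ⊤, hTD (.inl hStop), top_le_iff.1 (hA.1 ⊤).1, by simp⟩
        · refine hclosed a (.inr (.inl ha)) ?_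
          obtain ⟨b, -, rfl⟩ := ha
          exact (hA.1 b).2
        · refine hclosed a (.inr (.inr ha)) ?_
          obtain ⟨_, ⟨b, -, rfl⟩, rfl⟩ := ha
          exact hA.dia_compl (hA.1 b).2
      · rintro _ ⟨b, hb, c, hc, hcc, rfl⟩ _ ⟨b', hb', c', hc', hcc', rfl⟩
        exact ⟨b ⊓ b', hSinf hb hb', c ⊓ c', hD.infClosed hc hc',
          by rw [hA.dia_inf c hcc', hcc], by rw [inf_inf_inf_comm]⟩
    have hmin : supClosure (infClosure T) ⊆ {x | A.dia x ∈ latticeClosure T} := by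
      apply supClosure_min
      · intro x hx
        obtain ⟨b, hb, c, hc, hcc, rfl⟩ := hN hx
        change A.dia (b ⊓ c) ∈ latticeClosure T
        rw [hA.dia_inf b hcc]
        exact hD.infClosed (hTD (.inr (.inl ⟨b, hb, rfl⟩))) hc
      · intro x hx y hy
        change A.dia (x ⊔ y) ∈ latticeClosure T
        rw [A.dia_sup]
        exact hD.supClosed hx hy
    rw [supClosure_infClosure] at hmin
    exact fun a ha => hmin ha

end Monadic

/-! ### Finiteness of free monadic algebras of finite rank -/

section FreeMonadic

theorem free_isMonadic {K : Set ModalAlg.{u}} (hK : ∀ A ∈ K, A.IsMonadic) (X : Type) :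
    (free K X).IsMonadic := by
  refine ⟨fun a => ⟨?_, ?_⟩, fun a => ?_⟩
  · refine sup_eq_right.1 ?_
    exact Quotient.inductionOn a fun s => Quotient.sound fun A hA f =>
      sup_eq_right.2 ((hK A hA).1 _).1
  · exact Quotient.inductionOn a fun s => Quotient.sound fun A hA f => ((hK A hA).1 _).2
  · exact Quotient.inductionOn a fun s => Quotient.sound fun A hA f => (hK A hA).2 _

theorem freeRank_finite {K : Set ModalAlg.{u}} (hK : ∀ A ∈ K, A.IsMonadic) (k : ℕ) :
    Finite (freeRank K k) := by
  obtain ⟨D, hfin, hV, hD, hbot, htop, hcompl, hdia⟩ :=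
    (free_isMonadic hK (Fin k)).exists_finite_closed
      (Set.finite_range fun i => free.mk K (Fin k) (.var i))
  have hall : ∀ t : ModalTerm (Fin k), free.mk K (Fin k) t ∈ D := by
    intro t
    induction t with
    | var x => exact hV ⟨x, rfl⟩
    | bot => exact hbot
    | top => exact htop
    | sup s t hs ht => exact hD.supClosed hs ht
    | inf s t hs ht => exact hD.infClosed hs ht
    | compl s hs => exact hcompl _ hs
    | dia s hs => exact hdia _ hs
  exact Set.finite_univ_iff.1 (hfin.subset fun a _ => Quotient.inductionOn a hall)

end FreeMonadic

/-! ### Structure of finite monadic algebras -/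

section FiniteMonadic

/-- The powerset algebra of a set `X`, in which `◇ s` is everything for nonempty `s`. -/
def cluster (X : Type) : ModalAlg.{0} where
  carrier := Set X
  dia s := {_x | s.Nonempty}
  dia_bot := by ext; simp
  dia_sup s t := by ext; simp [Set.union_nonempty]

theorem cluster_isMonadic (X : Type) : (cluster X).IsMonadic := by
  refine ⟨fun a => ⟨fun x hx => ⟨x, hx⟩, ?_⟩, fun a => ?_⟩
  · change ({_x | Set.Nonempty {_x : X | Set.Nonempty a}} : Set X) = {_x | Set.Nonempty a}
    ext x
    exact ⟨fun ⟨_, h⟩ => h, fun h => ⟨x, h⟩⟩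
  · change ({_x | Set.Nonempty {_x : X | Set.Nonempty (aᶜ : Set X)}ᶜ} : Set X)
      = {_x : X | Set.Nonempty (aᶜ : Set X)}ᶜ
    ext x
    exact ⟨fun ⟨_, h⟩ => h, fun h => ⟨x, h⟩⟩

/-- If distinct elements are related, their nonempty symmetric difference is related to `⊥`;
applying `◇` relates `⊤` to `⊥`. -/
theorem cluster_isSimple (X : Type) [Nonempty X] : (cluster X).IsSimple := by
  refine ⟨inferInstanceAs (Nontrivial (Set X)), fun θ => ?_⟩
  by_cases h : ∃ a b : cluster X, θ.r a b ∧ a ≠ b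
  · right
    obtain ⟨a, b, hab, hne⟩ := h
    have hd : θ.r ((a ⊓ bᶜ) ⊔ (b ⊓ aᶜ)) ⊥ := by
      have h1 := θ.sup (θ.inf hab (θ.refl bᶜ)) (θ.inf (θ.symm hab) (θ.refl aᶜ))
      simpa using h1
    have hne' : Set.Nonempty (((a ⊓ bᶜ) ⊔ (b ⊓ aᶜ) : cluster X) : Set X) := by
      refine Set.nonempty_iff_ne_empty.2 fun h0 => ?_
      have h2 : ((a ⊓ bᶜ) ⊔ (b ⊓ aᶜ) : cluster X) = ⊥ := h0
      rw [sup_eq_bot_iff, ← sdiff_eq, ← sdiff_eq, sdiff_eq_bot_iff, sdiff_eq_bot_iff] at h2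
      exact hne (le_antisymm h2.1 h2.2)
    have htop : θ.r ⊤ ⊥ := by
      have h3 := θ.dia hd
      rw [(cluster X).dia_bot] at h3
      convert h3 using 1
      exact (Set.eq_univ_of_forall fun _ => hne').symm
    have hbot : ∀ x : cluster X, θ.r x ⊥ := fun x => by
      simpa using θ.inf (θ.refl x) htop
    ext x y
    exact ⟨fun _ => trivial, fun _ => θ.trans (hbot x) (θ.symm (hbot y))⟩
  · left
    push Not at h
    ext x y
    exact ⟨fun hxy => h x y hxy, fun hxy => by
      have : x = y := hxy
      subst this
      exact θ.refl x⟩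

variable {A : ModalAlg.{0}}

/-- If `x ≤ ◇a`, then `◇(a ⊓ ◇x) = ◇a ⊓ ◇x ≠ ⊥`, so an atom `y` lies below `a ⊓ ◇x`. The same law
applied to `x ⊓ ◇y` gives the symmetric relation `x ≤ ◇y`. -/
theorem IsMonadic.atom_le_dia_iff [Finite A] (hA : A.IsMonadic) {x : A} (hx : IsAtom x) (a : A) :
    x ≤ A.dia a ↔ ∃ y, IsAtom y ∧ y ≤ a ∧ A.dia y = A.dia x := by
  constructor
  · intro hxa
    have hmeet : a ⊓ A.dia x ≠ ⊥ := by
      intro h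
      have h1 : A.dia a ⊓ A.dia x = ⊥ := by
        rw [← hA.dia_inf a (hA.1 x).2, h, A.dia_bot]
      exact hx.1 (le_bot_iff.1 (h1 ▸ le_inf hxa (hA.1 x).1))
    obtain ⟨y, hy, hle⟩ := (eq_bot_or_exists_atom_le (a ⊓ A.dia x)).resolve_left hmeet
    have hyx : y ≤ A.dia x := hle.trans inf_le_right
    have hxy : x ≤ A.dia y := by
      by_contra hn
      have h1 : x ⊓ A.dia y = ⊥ := (hx.not_le_iff_disjoint.1 hn).eq_bot
      have h2 : A.dia x ⊓ A.dia y = ⊥ := by rw [← hA.dia_inf x (hA.1 y).2, h1, A.dia_bot]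
      exact hy.1 (le_bot_iff.1 (h2 ▸ le_inf hyx (hA.1 y).1))
    exact ⟨y, hy, hle.trans inf_le_left,
      le_antisymm ((dia_mono hyx).trans (hA.1 x).2.le) ((dia_mono hxy).trans (hA.1 y).2.le)⟩
  · rintro ⟨y, -, hya, hyx⟩
    exact (hA.1 x).1.trans (hyx ▸ dia_mono hya)

/-- Every finite monadic algebra is a product of finite simple monadic algebras. -/
theorem IsMonadic.exists_isomorphic_prod [Finite A] (hA : A.IsMonadic) :
    ∃ (d m : ℕ) (R : Fin m → ModalAlg.{0}),
      (∀ l, (R l).IsMonadic ∧ (R l).IsSimple ∧ Finite (R l) ∧ 2 < Nat.card (R l)) ∧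
        Isomorphic A (prod (pi fun _ : Fin d => two) (pi R)) := by
  classical
  -- `P` collects the atoms alone in their class; `C` indexes the classes with at least two atoms by
  -- their common value of `◇`. The map `ψ` records the atoms below `a`, sorted by class.
  let P := {x : A // IsAtom x ∧ ∀ y, IsAtom y → A.dia y = A.dia x → y = x}
  let C := {c : A // ∃ x y, IsAtom x ∧ IsAtom y ∧ A.dia x = c ∧ A.dia y = c ∧ x ≠ y}
  let p := (Finite.equivFin P).symm
  let c := (Finite.equivFin C).symm
  let X : Fin (Nat.card C) → Type := fun l => {x : A // IsAtom x ∧ A.dia x = (c l).1}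
  have hcover : ∀ x : A, IsAtom x → (∃ i, x = (p i).1) ∨ ∃ l, A.dia x = (c l).1 := by
    intro x hx
    by_cases h : ∀ y, IsAtom y → A.dia y = A.dia x → y = x
    · exact .inl ⟨p.symm ⟨x, hx, h⟩, by simp⟩
    · push Not at h
      obtain ⟨y, hy, hyx, hne⟩ := h
      exact .inr ⟨c.symm ⟨A.dia x, y, x, hy, hx, hyx, rfl, hne⟩, by simp⟩
  have hdisj : ∀ i l, A.dia (p i).1 ≠ (c l).1 := by
    intro i l h
    obtain ⟨x, y, hx, hy, hxc, hyc, hne⟩ := (c l).2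
    exact hne (((p i).2.2 x hx (hxc.trans h.symm)).trans ((p i).2.2 y hy (hyc.trans h.symm)).symm)
  let R : Fin (Nat.card C) → ModalAlg.{0} := fun l => cluster (X l)
  let ψ : A → prod (pi fun _ : Fin (Nat.card P) => two) (pi R) := fun a =>
    (fun i => (decide ((p i).1 ≤ a) : Bool), fun l => ({x | x.1 ≤ a} : Set (X l)))
  have hle : ∀ a b, ψ a ≤ ψ b ↔ a ≤ b := by
    intro a b
    constructor
    · rintro ⟨h1, h2⟩
      rw [BooleanAlgebra.le_iff_atom_le_imp]
      intro x hx hxa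
      rcases hcover x hx with ⟨i, rfl⟩ | ⟨l, hl⟩
      · have h3 : (decide ((p i).1 ≤ a) : Bool) ≤ decide ((p i).1 ≤ b) := h1 i
        by_contra hn
        rw [decide_eq_true hxa, decide_eq_false hn] at h3
        exact absurd h3 (by decide)
      · have h3 : ({x | x.1 ≤ a} : Set (X l)) ⊆ {x | x.1 ≤ b} := h2 l
        exact @h3 ⟨x, hx, hl⟩ hxa
    · intro hab
      refine ⟨fun i => ?_, fun l => ?_⟩
      · change (decide ((p i).1 ≤ a) : Bool) ≤ decide ((p i).1 ≤ b)
        by_cases h : (p i).1 ≤ a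
        · simp [h, h.trans hab]
        · simp [h]
      · change ({x | x.1 ≤ a} : Set (X l)) ⊆ {x | x.1 ≤ b}
        exact fun x hx => le_trans hx hab
  have hsurj : Function.Surjective ψ := by
    rintro ⟨(f : Fin (Nat.card P) → Bool), (g : ∀ l, Set (X l))⟩
    let _ := Fintype.ofFinite A
    -- `Q` holds of the atoms prescribed by `f` and `g`; their join is the preimage.
    let Q : A → Prop := fun x => (∃ i, x = (p i).1 ∧ f i = true) ∨
      ∃ (l : _) (h : IsAtom x ∧ A.dia x = (c l).1), (⟨x, h⟩ : X l) ∈ g l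
    have hQatom : ∀ x, Q x → IsAtom x := by
      rintro x (⟨i, rfl, -⟩ | ⟨l, h, -⟩)
      exacts [(p i).2.1, h.1]
    have hQ : ∀ x, IsAtom x → (x ≤ (Finset.univ.filter Q).sup id ↔ Q x) := by
      intro x hx
      constructor
      · intro h
        by_contra hn
        have hdis : Disjoint x ((Finset.univ.filter Q).sup id) := by
          rw [Finset.disjoint_sup_right]
          intro y hy
          rw [← hx.not_le_iff_disjoint]
          intro hxy
          have hQy := (Finset.mem_filter.1 hy).2
          rcases (hQatom y hQy).le_iff.1 hxy with h0 | h0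
          · exact hx.1 h0
          · exact hn (h0 ▸ hQy)
        exact hx.1 (hdis.eq_bot_of_le h)
      · intro h
        exact Finset.le_sup (f := id) (Finset.mem_filter.2 ⟨Finset.mem_univ x, h⟩)
    refine ⟨(Finset.univ.filter Q).sup id, Prod.ext (funext fun i => ?_) (funext fun l => ?_)⟩
    · change (decide ((p i).1 ≤ (Finset.univ.filter Q).sup id) : Bool) = f i
      rw [Bool.eq_iff_iff, decide_eq_true_iff, hQ _ (p i).2.1]
      constructor
      · rintro (⟨j, hj, hf⟩ | ⟨l, h, -⟩)
        · rwa [p.injective (Subtype.ext hj)]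
        · exact absurd h.2 (hdisj i l)
      · exact fun h => .inl ⟨i, rfl, h⟩
    · change ({x | x.1 ≤ (Finset.univ.filter Q).sup id} : Set (X l)) = g l
      ext x
      change x.1 ≤ (Finset.univ.filter Q).sup id ↔ _
      rw [hQ _ x.2.1]
      constructor
      · rintro (⟨j, hj, hf⟩ | ⟨l', h, hg⟩)
        · exact absurd (hj ▸ x.2.2) (hdisj j l)
        · obtain rfl : l' = l := c.injective (Subtype.ext (h.2.symm.trans x.2.2))
          exact hg
      · exact fun h => .inr ⟨l, x.2, h⟩
  have hinj : Function.Injective ψ := fun a b h =>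
    le_antisymm ((hle a b).1 h.le) ((hle b a).1 h.ge)
  refine ⟨_, _, R, fun l => ?_, ⟨⟨⟨Equiv.ofBijective ψ ⟨hinj, hsurj⟩, fun {a b} => hle a b⟩, ?_⟩⟩⟩
  · obtain ⟨x, y, hx, hy, hxc, hyc, hne⟩ := (c l).2
    have : Nontrivial (X l) := ⟨⟨x, hx, hxc⟩, ⟨y, hy, hyc⟩, fun h => hne (congrArg Subtype.val h)⟩
    refine ⟨cluster_isMonadic _, cluster_isSimple _, inferInstanceAs (Finite (Set (X l))), ?_⟩
    change 2 < Nat.card (Set (X l))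
    let _ := Fintype.ofFinite (X l)
    rw [Nat.card_eq_fintype_card, Fintype.card_set]
    calc 2 < 2 ^ 2 := by norm_num
      _ ≤ _ := Nat.pow_le_pow_right (by norm_num) Fintype.one_lt_card
  · intro a
    refine Prod.ext (funext fun i => ?_) (funext fun l => ?_)
    · change (decide ((p i).1 ≤ A.dia a) : Bool) = decide ((p i).1 ≤ a)
      rw [Bool.eq_iff_iff, decide_eq_true_iff, decide_eq_true_iff,
        hA.atom_le_dia_iff (p i).2.1]
      constructor
      · rintro ⟨y, hy, hya, h⟩
        rwa [← (p i).2.2 y hy h]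
      · exact fun h => ⟨_, (p i).2.1, h, rfl⟩
    · change ({x | x.1 ≤ A.dia a} : Set (X l)) = {_x | Set.Nonempty ({x | x.1 ≤ a} : Set (X l))}
      ext x
      change x.1 ≤ A.dia a ↔ _
      rw [hA.atom_le_dia_iff x.2.1]
      constructor
      · rintro ⟨y, hy, hya, h⟩
        exact ⟨⟨y, hy, h.trans x.2.2⟩, hya⟩
      · rintro ⟨y, hya⟩
        exact ⟨y.1, y.2.1, hya, y.2.2.trans x.2.2.symm⟩

end FiniteMonadic

/-! ### Term evaluation and equational theories -/

section Evaluation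

theorem Hom.map_eval {A : ModalAlg.{u}} {B : ModalAlg.{v}} (h : Hom A B) {X : Type w}
    (f : X → A) (t : ModalTerm X) :
    h.toFun (t.eval A f) = t.eval B fun x => h.toFun (f x) := by
  induction t with
  | var x => rfl
  | bot => exact h.map_bot'
  | top => exact h.map_top'
  | sup s t hs ht => exact (h.map_sup' _ _).trans (congrArg₂ (· ⊔ ·) hs ht)
  | inf s t hs ht => exact (h.map_inf' _ _).trans (congrArg₂ (· ⊓ ·) hs ht)
  | compl s hs => exact (map_compl' h.toBoundedLatticeHom _).trans (congrArg (·ᶜ) hs)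
  | dia s hs => exact (h.map_dia' _).trans (congrArg B.dia hs)

/-- The homomorphism underlying an isomorphism. -/
def Iso.toHom {A : ModalAlg.{u}} {B : ModalAlg.{v}} (e : Iso A B) : Hom A B where
  toFun := e.toFun
  map_sup' := map_sup e.toRelIso
  map_inf' := map_inf e.toRelIso
  map_top' := map_top e.toRelIso
  map_bot' := map_bot e.toRelIso
  map_dia' := e.map_dia'

theorem eval_prod {A : ModalAlg.{u}} {B : ModalAlg.{v}} {X : Type w} (f : X → prod A B)
    (t : ModalTerm X) :
    t.eval (prod A B) f = (t.eval A fun x => (f x).1, t.eval B fun x => (f x).2) := by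
  induction t with
  | var x => rfl
  | bot => rfl
  | top => rfl
  | sup s t hs ht => exact congrArg₂ (· ⊔ ·) hs ht
  | inf s t hs ht => exact congrArg₂ (· ⊓ ·) hs ht
  | compl s hs => exact congrArg (·ᶜ) hs
  | dia s hs => exact congrArg (prod A B).dia hs

theorem eval_pi {ι : Type v} {A : ι → ModalAlg.{u}} {X : Type w} (f : X → pi A)
    (t : ModalTerm X) : t.eval (pi A) f = fun i => t.eval (A i) fun x => f x i := by
  induction t with
  | var x => rfl
  | bot => rfl
  | top => rfl
  | sup s t hs ht => exact congrArg₂ (· ⊔ ·) hs ht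
  | inf s t hs ht => exact congrArg₂ (· ⊓ ·) hs ht
  | compl s hs => exact congrArg (·ᶜ) hs
  | dia s hs => exact congrArg (pi A).dia hs

theorem free.eval_var (K : Set ModalAlg.{u}) (X : Type) (t : ModalTerm X) :
    t.eval (free K X) (fun x => free.mk K X (.var x)) = free.mk K X t := by
  rw [free.eval_mk K X ModalTerm.var t]
  congr 1
  induction t <;> simp_all [ModalTerm.subst]

/-- Any valuation in an algebra of the generated variety factors through the free algebra of `K`,
where `s` and `t` already coincide. -/
theorem termSetoid_generated (K : Set ModalAlg.{u}) (k : ℕ) (s t : ModalTerm (Fin k)) :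
    termSetoid (generated K : Set ModalAlg.{u}) (Fin k) s t ↔ termSetoid K (Fin k) s t := by
  constructor
  · exact fun h A hA f => h A (fun e he => he A hA) f
  · intro h A hA f
    obtain ⟨φ, hφ, -⟩ := freeRank_lift K k A hA f
    have key : ∀ r : ModalTerm (Fin k), φ.toFun (free.mk K (Fin k) r) = r.eval A f := fun r => by
      rw [← free.eval_var, φ.map_eval]
      exact congrArg (fun g => r.eval A g) (funext hφ)
    rw [← key, ← key]
    exact congrArg _ (Quotient.sound h)

/-- The McKinsey term applied to a term. -/
def mckinseyTerm {X : Type u} (t : ModalTerm X) : ModalTerm X :=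
  .sup (.compl (.compl (.dia (.compl (.dia t))))) (.dia (.compl (.dia (.compl t))))

theorem eval_mckinseyTerm {X : Type u} (A : ModalAlg.{v}) (f : X → A) (t : ModalTerm X) :
    (mckinseyTerm t).eval A f = A.mckinsey (t.eval A f) := rfl

end Evaluation

/-! ### The two-element algebra inside McKinsey algebras -/

section McKinsey

/-- The identity at `⊥` reads `◇⊤ ⊔ ◇□⊥ = ⊤`, and the second joinand lies below the first. This
makes `{⊥, ⊤}` a copy of `2` when `A` is nontrivial. -/
theorem IsMcKinsey.dia_top {A : ModalAlg.{u}} (hA : A.IsMcKinsey) : A.dia ⊤ = ⊤ := by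
  have h := hA ⊥
  simp only [mckinsey, box, A.dia_bot, compl_bot, compl_compl] at h
  exact top_le_iff.1 (h.symm.le.trans (sup_le le_rfl (dia_mono le_top)))

/-- The homomorphism from the two-element closure algebra to a McKinsey algebra. -/
def IsMcKinsey.twoHom {A : ModalAlg.{u}} (hA : A.IsMcKinsey) : Hom two A where
  toFun b := bif b then ⊤ else ⊥
  map_sup' := by
    rintro (_ | _) (_ | _)
    exacts [(sup_idem ⊥).symm, (bot_sup_eq ⊤).symm, (sup_bot_eq ⊤).symm, (sup_idem ⊤).symm]
  map_inf' := by
    rintro (_ | _) (_ | _)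
    exacts [(inf_idem ⊥).symm, (bot_inf_eq ⊤).symm, (inf_bot_eq ⊤).symm, (inf_idem ⊤).symm]
  map_top' := rfl
  map_bot' := rfl
  map_dia' := by
    rintro (_ | _)
    exacts [A.dia_bot.symm, hA.dia_top.symm]

theorem IsMcKinsey.eval_two_eq {A : ModalAlg.{u}} [Nontrivial A] (hA : A.IsMcKinsey)
    {X : Type v} {s t : ModalTerm X} (h : ∀ f : X → A, s.eval A f = t.eval A f) (f : X → two) :
    s.eval two f = t.eval two f := by
  have h1 := h fun x => hA.twoHom.toFun (f x)
  rw [← Hom.map_eval, ← Hom.map_eval] at h1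
  have hinj : Function.Injective hA.twoHom.toFun := by
    rintro (_ | _) (_ | _) h2
    · rfl
    · exact absurd h2 bot_ne_top
    · exact absurd h2 top_ne_bot
    · rfl
  exact hinj h1

end McKinsey

/-! ### The free algebra of the join -/

section Join

variable {U W : Set ModalAlg.{u}} {k d m : ℕ} {R : Fin m → ModalAlg.{0}}

/-- A bijective homomorphism yields an isomorphism. -/
theorem isomorphic_of_bijective {A : ModalAlg.{u}} {B : ModalAlg.{v}} (h : Hom A B)
    (hb : Function.Bijective h.toFun) : Isomorphic A B := by
  refine ⟨⟨⟨Equiv.ofBijective h.toFun hb, fun {a b} => ?_⟩, h.map_dia'⟩⟩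
  change h.toFun a ≤ h.toFun b ↔ a ≤ b
  rw [← sup_eq_right, ← sup_eq_right, ← hb.1.eq_iff]
  exact Eq.congr_left (h.map_sup' a b).symm

theorem isomorphic_freeRank_varJoin (hUnontriv : ∃ A ∈ U, Nontrivial A)
    (hUmck : ∀ A ∈ U, A.IsMcKinsey) (hR : IsSimpleDecomposition W k d m R) :
    Isomorphic (freeRank (varJoin U W) k) (prod (freeRank U k) (pi R)) := by
  obtain ⟨hRl, ⟨e⟩⟩ := hR
  let g : Fin k → prod (pi fun _ : Fin d => two) (pi R) := fun i =>
    e.toFun (free.mk W (Fin k) (.var i))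
  have he : ∀ t, e.toFun (free.mk W (Fin k) t) =
      ((t.eval (pi fun _ : Fin d => two) fun i => (g i).1), t.eval (pi R) fun i => (g i).2) := by
    intro t
    rw [← free.eval_var]
    exact (e.toHom.map_eval _ t).trans (eval_prod g t)
  let G : ModalTerm (Fin k) → pi R := fun t => t.eval (pi R) fun i => (g i).2
  have hU_join : ∀ {s t}, termSetoid (varJoin U W) (Fin k) s t ↔ termSetoid (U ∪ W) (Fin k) s t :=
    fun {s t} => termSetoid_generated (U ∪ W) k s t
  have hW_eq : ∀ {s t}, termSetoid W (Fin k) s t → G s = G t := by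
    intro s t h
    have h1 : free.mk W (Fin k) s = free.mk W (Fin k) t := Quotient.sound h
    have h2 := congrArg e.toFun h1
    rw [he, he] at h2
    exact congrArg Prod.snd h2
  let F : FreeCarrier (varJoin U W) (Fin k) → prod (freeRank U k) (pi R) :=
    Quotient.lift (fun t => (free.mk U (Fin k) t, G t)) fun s t h =>
      Prod.ext (Quotient.sound fun A hA f => hU_join.1 h A (.inl hA) f)
        (hW_eq fun A hA f => hU_join.1 h A (.inr hA) f)
  let Φ : Hom (freeRank (varJoin U W) k) (prod (freeRank U k) (pi R)) :=
    { toFun := F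
      map_sup' := fun a b => Quotient.inductionOn₂ a b fun _ _ => rfl
      map_inf' := fun a b => Quotient.inductionOn₂ a b fun _ _ => rfl
      map_top' := rfl
      map_bot' := rfl
      map_dia' := fun a => Quotient.inductionOn a fun _ => rfl }
  refine isomorphic_of_bijective Φ ⟨fun a b => ?_, ?_⟩
  · refine Quotient.inductionOn₂ a b fun s t hst => Quotient.sound (hU_join.2 ?_)
    have h1 : termSetoid U (Fin k) s t := Quotient.exact (congrArg Prod.fst hst)
    have h2 : G s = G t := congrArg Prod.snd hst
    obtain ⟨B, hB, hBn⟩ := hUnontriv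
    -- Equality in `F_W(k)` is tested on `2^d × G`: the `G` part is `h2`, and each coordinate `2`
    -- inherits the identity from `B ∈ U`.
    have h3 : termSetoid W (Fin k) s t := by
      refine Quotient.exact (e.injective ((he s).trans (Eq.trans ?_ (he t).symm)))
      refine Prod.ext ?_ h2
      change s.eval (pi fun _ : Fin d => two) _ = t.eval (pi fun _ : Fin d => two) _
      rw [eval_pi, eval_pi]
      exact funext fun i => (hUmck B hB).eval_two_eq (h1 B hB) _
    rintro A (hA | hA) f
    exacts [h1 A hA f, h3 A hA f]
  · have hGsurj : Function.Surjective G := by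
      intro y
      obtain ⟨a, ha⟩ := e.surjective ((⊥, y) : prod (pi fun _ : Fin d => two) (pi R))
      obtain ⟨t, rfl⟩ := Quotient.exists_rep a
      exact ⟨t, congrArg Prod.snd ((he t).symm.trans ha)⟩
    have hne : ∀ l, ∃ a : R l, a ≠ ⊥ ∧ a ≠ ⊤ := by
      intro l
      obtain ⟨-, -, hfin, hcard⟩ := hRl l
      by_contra! h
      have hsurj : Function.Surjective fun b : Bool => (bif b then ⊤ else ⊥ : R l) := by
        intro a
        by_cases ha : a = ⊥
        · exact ⟨false, ha.symm⟩
        · exact ⟨true, (h a ha).symm⟩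
      have := Nat.card_le_card_of_surjective _ hsurj
      simp at this
      omega
    choose a ha0 ha1 using hne
    -- Surjectivity onto the whole product gives one term serving all `l` at once, even if some `R
    -- l` coincide.
    obtain ⟨r, hr⟩ := hGsurj a
    have hrG : G (mckinseyTerm r) = (⊥ : pi R) := by
      refine Eq.trans (eval_pi _ _) (funext fun l => ?_)
      have hrl : (r.eval (R l) fun i => (g i).2 l) = a l := by
        rw [← hr]
        exact (congrFun (eval_pi (A := R) (fun i => (g i).2) r) l).symm
      rw [eval_mckinseyTerm, hrl]
      exact (hRl l).1.mckinsey_eq_bot (hRl l).2.1 (ha0 l) (ha1 l)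
    have hrU : free.mk U (Fin k) (mckinseyTerm r) = (⊤ : freeRank U k) :=
      Quotient.sound fun A hA f => hUmck A hA _
    rintro ⟨x, y⟩
    obtain ⟨s, rfl⟩ := Quotient.exists_rep x
    obtain ⟨t, rfl⟩ := hGsurj y
    -- `μ(r)` acts as a switch: it selects `s` over `U` and `t` in `G`.
    refine ⟨free.mk _ _ (.sup (.inf (mckinseyTerm r) s) (.inf (.compl (mckinseyTerm r)) t)),
      Prod.ext ?_ ?_⟩
    · change (free.mk U (Fin k) (mckinseyTerm r) ⊓ free.mk U (Fin k) s) ⊔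
        ((free.mk U (Fin k) (mckinseyTerm r))ᶜ ⊓ free.mk U (Fin k) t) = free.mk U (Fin k) s
      rw [hrU]
      simp
    · change (G (mckinseyTerm r) ⊓ G s) ⊔ ((G (mckinseyTerm r))ᶜ ⊓ G t) = G t
      rw [hrG]
      simp

end Join

end ModalAlg

theorem proposition8p3 (U W : Set ModalAlg.{u})
    (hU : ModalAlg.IsVariety U) (hUnontriv : ∃ A ∈ U, Nontrivial A)
    (hUmck : ∀ A ∈ U, ModalAlg.IsMcKinsey A)
    (hW : ModalAlg.IsVariety W) (hWmon : ∀ A ∈ W, ModalAlg.IsMonadic A) (k : ℕ) :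
    (∃ (d m : ℕ) (R : Fin m → ModalAlg.{0}), ModalAlg.IsSimpleDecomposition W k d m R) ∧
    ∀ (d m : ℕ) (R : Fin m → ModalAlg.{0}), ModalAlg.IsSimpleDecomposition W k d m R →
      ModalAlg.Isomorphic (ModalAlg.freeRank (ModalAlg.varJoin U W) k)
        (ModalAlg.prod (ModalAlg.freeRank U k) (ModalAlg.pi R)) := by
  refine ⟨?_, fun d m R hR => ModalAlg.isomorphic_freeRank_varJoin hUnontriv hUmck hR⟩
  have := ModalAlg.freeRank_finite hWmon k
  exact (ModalAlg.free_isMonadic hWmon (Fin k)).exists_isomorphic_prod
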